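/- Let $n\ge 1$, $q\in[0,n)$, let $\Omega\subset\mathbb{R}^n$ be a bounded convex open set, and let $v\in C(\overline\Omega)$, $v\not\equiv 0$, be a convex non-negative function satisfying $$\det D^2 v\ \ge\ v^q\chi_{\{v>0\}}\quad\text{in }\Omega$$ in the sense of Aleksandrov, that is, $|\partial v(A)|\ge\int_{A\cap\{v>0\}}v^q\,dx$ for every Borel set $A\subset\Omega$, where $\partial v(A)=\bigcup_{x\in A}\partial v(x)$ is the image of $A$ under the subdifferential of $v$ and $|\cdot|$ is Lebesgue measure. Let $K=\{x\in\Omega: v(x)=0\}$ be the coincidence set, $\Gamma=\Omega\cap\partial K$ the free boundary, $\Gamma_{sc}$ the set of exposed points of $K$, and $\Gamma_{nsc}=\Gamma\setminus\Gamma_{sc}$. Then every convex subset $E\subset\Gamma_{nsc}$ satisfies $$\dim E<\frac{n+q}{2},$$ where $\dim E$ is the dimension of the affine hull of $E$ (taken as $0$ if $E=\emptyset$). Furthermore, if there are a point $x_0\in\overline E\cap\partial\Omega$ and constants $C\in\mathbb{R}$ and $s>1$ such that $$v(x)\le C|x-x_0|^s\quad\text{for all }x\in\partial\Omega,$$ then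 $$\dim E\le n-\frac{(n-q)s}{2}.$$ -/

import Mathlib

open MeasureTheory

namespace MAObstacle

/-- The subdifferential at `x` of a function `v` on `Ω`: the slopes of the affine functions that
touch the graph of `v` over `Ω` from below at `x`. -/
def subdifferential {n : ℕ} (Ω : Set (EuclideanSpace ℝ (Fin n)))
    (v : EuclideanSpace ℝ (Fin n) → ℝ) (x : EuclideanSpace ℝ (Fin n)) :
    Set (EuclideanSpace ℝ (Fin n)) :=
  {p | ∀ y ∈ Ω, v x + inner ℝ p (y - x) ≤ v y}

/-- The Monge-Ampère measure of `v` on subsets `A` of `Ω`: the Lebesgue measure of the image of `A`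
under the subdifferential map. -/
noncomputable def mongeAmpere {n : ℕ} (Ω : Set (EuclideanSpace ℝ (Fin n)))
    (v : EuclideanSpace ℝ (Fin n) → ℝ) (A : Set (EuclideanSpace ℝ (Fin n))) : ENNReal :=
  volume (⋃ x ∈ A, subdifferential Ω v x)

/-- `det D²v ≥ v ^ q χ_{v > 0}` in `Ω`, in the sense of Aleksandrov. -/
def IsSubsolution {n : ℕ} (Ω : Set (EuclideanSpace ℝ (Fin n))) (q : ℝ)
    (v : EuclideanSpace ℝ (Fin n) → ℝ) : Prop :=
  ∀ A : Set (EuclideanSpace ℝ (Fin n)), MeasurableSet A → A ⊆ Ω →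
    ∫⁻ x in A, ENNReal.ofReal (Set.indicator {x | 0 < v x} (fun x => v x ^ q) x)
      ≤ mongeAmpere Ω v A

/-- The coincidence set `K` of `v` in `Ω`. -/
def coincidenceSet {n : ℕ} (Ω : Set (EuclideanSpace ℝ (Fin n)))
    (v : EuclideanSpace ℝ (Fin n) → ℝ) : Set (EuclideanSpace ℝ (Fin n)) :=
  {x | x ∈ Ω ∧ v x = 0}

/-- The free boundary `Γ = Ω ∩ ∂K`. -/
def freeBoundary {n : ℕ} (Ω : Set (EuclideanSpace ℝ (Fin n)))
    (v : EuclideanSpace ℝ (Fin n) → ℝ) : Set (EuclideanSpace ℝ (Fin n)) :=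
  Ω ∩ frontier (coincidenceSet Ω v)

/-- The strictly convex part of the free boundary: the exposed points of `K`. -/
def strictlyConvexPart {n : ℕ} (Ω : Set (EuclideanSpace ℝ (Fin n)))
    (v : EuclideanSpace ℝ (Fin n) → ℝ) : Set (EuclideanSpace ℝ (Fin n)) :=
  (coincidenceSet Ω v).exposedPoints ℝ

/-- The non-strictly convex part of the free boundary. -/
def nonStrictlyConvexPart {n : ℕ} (Ω : Set (EuclideanSpace ℝ (Fin n)))
    (v : EuclideanSpace ℝ (Fin n) → ℝ) : Set (EuclideanSpace ℝ (Fin n)) :=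
  freeBoundary Ω v \ strictlyConvexPart Ω v

/-- The dimension of a convex set: the dimension of its affine hull (`0` for the empty set). -/
noncomputable def convexDim {n : ℕ} (E : Set (EuclideanSpace ℝ (Fin n))) : ℕ :=
  Module.finrank ℝ (affineSpan ℝ E).direction

end MAObstacle

/-!
Suppose `E` spans dimension `k` and put `d = n - k`. Since `E` lies in the free boundary, `v`
vanishes on a relative ball around a relative interior point `x₁` of `E`, in the direction `V` of
`E`, but not on any neighbourhood of `x₁` (`IsFlatPoint`). Let `S` be the supremum of `v` over the
ball of radius `ε` around `x₁`.

By convexity `v ≤ S` on a box of fixed size along `V` and of size comparable to `ε` orthogonally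
to `V`. The slopes of `v` there are `O(S)` along `V` and `O(S / ε)` orthogonally to it, so their
images fill a set of measure `O(S ^ k (S / ε) ^ d)`. On the other hand, if `v` is comparable to `S`
somewhere in the ball of radius `ε / 8`, then by a midpoint argument it is so on half of a box, and
the integral of `v ^ q` is at least a constant times `S ^ q ε ^ d`. The Aleksandrov inequality
(`box_estimate`) then yields `ε ^ (2 d) ≤ C S ^ (n - q)`. A growth bound `S ≤ C ε ^ s` along
arbitrarily small such `ε` forces `s (n - q) ≤ 2 d`, that is, `k ≤ n - (n - q) s / 2`
(`mul_le_two_mul_finrank_orthogonal`).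

* The comparability holds at arbitrarily small scales, because `v` cannot vanish to infinite order
  at `x₁`: the same estimate with `V = 0` shows that `v` doubles within a distance
  `O(v ^ ((n - q) / (2 n)))` of any point where it is positive (`exists_mul_le_rpow`,
  `exists_doubling_radius`).
* Since `v` is Lipschitz near `x₁`, `s = 1` is always allowed and `k ≤ (n + q) / 2`. Equality is
  excluded because the components orthogonal to `V` of the slopes near `x₁` accumulate only on the
  boundary of the convex set of slopes at `x₁`, a null set, which improves the upper bound by a
  factor tending to zero (`two_mul_finrank_orthogonal_ne`).
* If `v` is bounded by `C ‖x - x₀‖ ^ s` on the boundary of the domain for some boundary point `x₀`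
  in the closure of `E`, projecting from a point of `E` on the far side of `x₁` transfers this
  growth to `x₁` (`exists_growth_of_frontier`).
-/

namespace MAObstacle

open Module Metric Set
open scoped ENNReal

variable {n : ℕ}

/-! ### Convex subsolutions and orthogonal boxes -/

/-- A nonnegative convex Aleksandrov subsolution on a bounded convex open set. -/
structure IsConvexSubsolution (Ω : Set (EuclideanSpace ℝ (Fin n))) (q : ℝ)
    (v : EuclideanSpace ℝ (Fin n) → ℝ) : Prop where
  isOpen : IsOpen Ω
  isBounded : Bornology.IsBounded Ω
  continuousOn : ContinuousOn v Ω
  convexOn : ConvexOn ℝ Ω v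
  nonneg : ∀ x ∈ Ω, 0 ≤ v x
  q_nonneg : 0 ≤ q
  isSubsolution : IsSubsolution Ω q v

/-- The closed box centred at `z` of radius `a` along `V` and radius `b` orthogonally to `V`. -/
def box (V : Submodule ℝ (EuclideanSpace ℝ (Fin n))) (z : EuclideanSpace ℝ (Fin n)) (a b : ℝ) :
    Set (EuclideanSpace ℝ (Fin n)) :=
  {x | ‖V.orthogonalProjectionOnto (x - z)‖ ≤ a ∧ ‖Vᗮ.orthogonalProjectionOnto (x - z)‖ ≤ b}

lemma volume_setOf_projection_mem (V : Submodule ℝ (EuclideanSpace ℝ (Fin n)))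
    (S : Set V) (T : Set Vᗮ) :
    volume {x | V.orthogonalProjectionOnto x ∈ S ∧ Vᗮ.orthogonalProjectionOnto x ∈ T}
      = volume S * volume T := by
  let e : EuclideanSpace ℝ (Fin n) ≃ᵐ V × Vᗮ :=
    V.orthogonalDecomposition.toHomeomorph.toMeasurableEquiv.trans (MeasurableEquiv.toLp 2 _).symm
  have he : MeasurePreserving e volume volume :=
    V.orthogonalDecomposition.measurePreserving.trans (WithLp.volume_preserving_ofLp _ _)
  have hset : {x | V.orthogonalProjectionOnto x ∈ S ∧ Vᗮ.orthogonalProjectionOnto x ∈ T}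
      = e ⁻¹' (S ×ˢ T) := by
    ext x
    simp [e]
  rw [hset, he.measure_preimage_equiv, Measure.volume_eq_prod, Measure.prod_prod]

lemma volume_closedBall_eq (V : Submodule ℝ (EuclideanSpace ℝ (Fin n))) {a : ℝ} (ha : 0 ≤ a) :
    volume (closedBall (0 : V) a)
      = ENNReal.ofReal (a ^ finrank ℝ V) * volume (ball (0 : V) 1) :=
  Measure.addHaar_closedBall _ _ ha

lemma volume_box (V : Submodule ℝ (EuclideanSpace ℝ (Fin n))) (z : EuclideanSpace ℝ (Fin n))
    {a b : ℝ} (ha : 0 ≤ a) (hb : 0 ≤ b) :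
    volume (box V z a b)
      = ENNReal.ofReal (a ^ finrank ℝ V) * volume (ball (0 : V) 1) *
        (ENNReal.ofReal (b ^ finrank ℝ Vᗮ) * volume (ball (0 : Vᗮ) 1)) := by
  have h : box V z a b = (fun x => x - z) ⁻¹'
      {x | V.orthogonalProjectionOnto x ∈ closedBall (0 : V) a ∧
        Vᗮ.orthogonalProjectionOnto x ∈ closedBall (0 : Vᗮ) b} := by
    ext x
    simp only [box, mem_ofPred_eq, mem_preimage, mem_closedBall_zero_iff]
  simp_rw [sub_eq_add_neg] at h
  rw [h, measure_preimage_add_right, volume_setOf_projection_mem, volume_closedBall_eq V ha,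
    volume_closedBall_eq Vᗮ hb]

lemma isClosed_box (V : Submodule ℝ (EuclideanSpace ℝ (Fin n))) (z : EuclideanSpace ℝ (Fin n))
    (a b : ℝ) : IsClosed (box V z a b) := by
  apply IsClosed.inter
  · exact isClosed_le (f := fun x => ‖V.orthogonalProjectionOnto (x - z)‖)
      (by fun_prop) continuous_const
  · exact isClosed_le (f := fun x => ‖Vᗮ.orthogonalProjectionOnto (x - z)‖)
      (by fun_prop) continuous_const

lemma box_subset_box (V : Submodule ℝ (EuclideanSpace ℝ (Fin n))) (z : EuclideanSpace ℝ (Fin n))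
    {a b a' b' : ℝ} (ha : a ≤ a') (hb : b ≤ b') : box V z a b ⊆ box V z a' b' :=
  fun _ hx => ⟨hx.1.trans ha, hx.2.trans hb⟩

lemma reflect_mem_box {V : Submodule ℝ (EuclideanSpace ℝ (Fin n))}
    {z x : EuclideanSpace ℝ (Fin n)} {a b : ℝ} (hx : x ∈ box V z a b) :
    z + z - x ∈ box V z a b := by
  have h : z + z - x - z = -(x - z) := by abel
  simp only [box, mem_ofPred_eq, h, map_neg, norm_neg]
  exact hx

/-- A vector of `W` that pairs to at most `S` with all vectors of `W` of norm `≤ a` is short. -/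
lemma norm_le_div_of_forall_inner_le {W : Submodule ℝ (EuclideanSpace ℝ (Fin n))}
    {p : EuclideanSpace ℝ (Fin n)} {a S : ℝ} (ha : 0 < a) (hS : 0 ≤ S)
    (h : ∀ w ∈ W, ‖w‖ ≤ a → inner ℝ p w ≤ S) : ‖W.orthogonalProjectionOnto p‖ ≤ S / a := by
  set u : W := W.orthogonalProjectionOnto p with hu
  rcases eq_or_ne u 0 with h0 | h0
  · rw [h0, norm_zero]; positivity
  have hpos : 0 < ‖u‖ := norm_pos_iff.2 h0
  have h1 := h ((a / ‖u‖) • (u : EuclideanSpace ℝ (Fin n))) (W.smul_mem _ u.2) (by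
    rw [norm_smul, Real.norm_eq_abs, abs_of_pos (by positivity), Submodule.coe_norm,
      div_mul_cancel₀ _ (by exact hpos.ne')])
  have h2 : inner ℝ p (u : EuclideanSpace ℝ (Fin n)) = ‖u‖ ^ 2 := by
    rw [← Submodule.inner_orthogonalProjectionOnto_eq_of_mem_right, ← hu,
      real_inner_self_eq_norm_sq]
  rw [inner_smul_right, h2] at h1
  rw [le_div_iff₀ ha]
  calc ‖u‖ * a = a / ‖u‖ * ‖u‖ ^ 2 := by field_simp
    _ ≤ S := h1

lemma add_mem_box {V : Submodule ℝ (EuclideanSpace ℝ (Fin n))}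
    {z x w : EuclideanSpace ℝ (Fin n)} {a b : ℝ} (hx : x ∈ box V z a b) (hw : w ∈ box V 0 a b) :
    x + w ∈ box V z (2 * a) (2 * b) := by
  have h : x + w - z = (x - z) + (w - 0) := by abel
  simp only [box, mem_ofPred_eq, h, map_add]
  exact ⟨(norm_add_le _ _).trans (by linarith [hx.1, hw.1]),
    (norm_add_le _ _).trans (by linarith [hx.2, hw.2])⟩

lemma mem_box_zero_of_mem {V : Submodule ℝ (EuclideanSpace ℝ (Fin n))}
    {w : EuclideanSpace ℝ (Fin n)} {a b : ℝ} (hw : w ∈ V) (ha : ‖w‖ ≤ a) (hb : 0 ≤ b) :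
    w ∈ box V 0 a b := by
  have h2 : Vᗮ.orthogonalProjectionOnto w = 0 :=
    Submodule.orthogonalProjectionOnto_orthogonal_apply_eq_zero hw
  simp only [box, mem_ofPred_eq, sub_zero, h2, norm_zero]
  exact ⟨(Submodule.norm_orthogonalProjectionOnto_apply_le V w).trans ha, hb⟩

lemma mem_box_zero_of_mem_orthogonal {V : Submodule ℝ (EuclideanSpace ℝ (Fin n))}
    {w : EuclideanSpace ℝ (Fin n)} {a b : ℝ} (hw : w ∈ Vᗮ) (ha : 0 ≤ a) (hb : ‖w‖ ≤ b) :
    w ∈ box V 0 a b := by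
  have h2 : V.orthogonalProjectionOnto w = 0 :=
    Submodule.orthogonalProjectionOnto_apply_of_mem_orthogonal hw
  simp only [box, mem_ofPred_eq, sub_zero, h2, norm_zero]
  exact ⟨ha, (Submodule.norm_orthogonalProjectionOnto_apply_le Vᗮ w).trans hb⟩

/-! ### The box estimate -/

/-- Comparison of the two sides of the Aleksandrov inequality on `box V z a b ∩ {v ≥ m}`. By
convexity this set and its reflection in `z` cover the box, so it fills at least half of it; the
slopes of `v` on it have components `≤ S / a` along `V` and lie in `T` orthogonally to `V`. -/
lemma IsConvexSubsolution.box_estimate {Ω : Set (EuclideanSpace ℝ (Fin n))} {q : ℝ}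
    {v : EuclideanSpace ℝ (Fin n) → ℝ} (h : IsConvexSubsolution Ω q v)
    (V : Submodule ℝ (EuclideanSpace ℝ (Fin n))) {z : EuclideanSpace ℝ (Fin n)} {a b m S : ℝ}
    (ha : 0 < a) (hb : 0 < b) (hm : 0 < m) (hΩ : box V z (2 * a) (2 * b) ⊆ Ω)
    (hS : ∀ x ∈ box V z (2 * a) (2 * b), v x ≤ S) (hz : m ≤ v z) (T : Set Vᗮ)
    (hT : ∀ x ∈ box V z a b, m ≤ v x → ∀ p ∈ subdifferential Ω v x,
      ‖V.orthogonalProjectionOnto p‖ ≤ S / a → ‖Vᗮ.orthogonalProjectionOnto p‖ ≤ S / b →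
        Vᗮ.orthogonalProjectionOnto p ∈ T) :
    ENNReal.ofReal (m ^ q / 2 * a ^ finrank ℝ V * b ^ finrank ℝ Vᗮ) * volume (ball (0 : Vᗮ) 1)
      ≤ ENNReal.ofReal ((S / a) ^ finrank ℝ V) * volume T := by
  set Q := box V z a b with hQ
  have hQΩ : Q ⊆ Ω := (box_subset_box V z (by linarith) (by linarith)).trans hΩ
  have hzbox : z ∈ box V z (2 * a) (2 * b) := by simp [box, ha.le, hb.le]
  have hS0 : 0 ≤ S := (h.nonneg z (hΩ hzbox)).trans (hS z hzbox)
  set A := Q ∩ v ⁻¹' Ici m with hA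
  have hAmeas : MeasurableSet A :=
    ((h.continuousOn.mono hQΩ).preimage_isClosed_of_isClosed (isClosed_box V z a b)
      isClosed_Ici).measurableSet
  have hAΩ : A ⊆ Ω := inter_subset_left.trans hQΩ
  have hcover : Q ⊆ A ∪ (fun x => z + z - x) ⁻¹' A := by
    intro x hx
    have hx' := reflect_mem_box hx
    by_cases hmx : m ≤ v x
    · exact Or.inl ⟨hx, hmx⟩
    · refine Or.inr ⟨hx', ?_⟩
      have hconv := h.convexOn.2 (hQΩ hx) (hQΩ hx') (one_half_pos (α := ℝ)).le
        (one_half_pos (α := ℝ)).le (add_halves (1 : ℝ))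
      have hmid : (1 / 2 : ℝ) • x + (1 / 2 : ℝ) • (z + z - x) = z := by module
      rw [hmid, smul_eq_mul, smul_eq_mul] at hconv
      simp only [mem_preimage, mem_Ici]
      linarith
  have hhalf : volume Q ≤ 2 * volume A := by
    calc volume Q ≤ volume A + volume ((fun x => z + z - x) ⁻¹' A) :=
          (measure_mono hcover).trans (measure_union_le _ _)
      _ = 2 * volume A := by
          rw [(Measure.measurePreserving_sub_left volume (z + z)).measure_preimage
            hAmeas.nullMeasurableSet, two_mul]
  have hlower : ENNReal.ofReal (m ^ q) * volume A ≤ mongeAmpere Ω v A := by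
    refine le_trans ?_ (h.isSubsolution A hAmeas hAΩ)
    rw [← setLIntegral_const]
    refine setLIntegral_mono' hAmeas fun x hx => ?_
    have hvx : m ≤ v x := hx.2
    have hmem : x ∈ {x | 0 < v x} := hm.trans_le hvx
    rw [indicator_of_mem hmem]
    exact ENNReal.ofReal_le_ofReal (Real.rpow_le_rpow hm.le hvx h.q_nonneg)
  have hupper : mongeAmpere Ω v A ≤
      ENNReal.ofReal ((S / a) ^ finrank ℝ V) * volume (ball (0 : V) 1) * volume T := by
    rw [← volume_closedBall_eq V (by positivity), ← volume_setOf_projection_mem]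
    refine measure_mono (iUnion₂_subset fun x hx p hp => ?_)
    have hslope : ∀ w ∈ box V 0 a b, inner ℝ p w ≤ S := by
      intro w hw
      have hxw := add_mem_box hx.1 hw
      have h1 := hp (x + w) (hΩ hxw)
      rw [add_sub_cancel_left] at h1
      linarith [hS _ hxw, h.nonneg x (hAΩ hx)]
    have hpV : ‖V.orthogonalProjectionOnto p‖ ≤ S / a :=
      norm_le_div_of_forall_inner_le ha hS0 fun w hw hwa =>
        hslope w (mem_box_zero_of_mem hw hwa hb.le)
    have hpW : ‖Vᗮ.orthogonalProjectionOnto p‖ ≤ S / b :=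
      norm_le_div_of_forall_inner_le hb hS0 fun w hw hwb =>
        hslope w (mem_box_zero_of_mem_orthogonal hw ha.le hwb)
    exact ⟨mem_closedBall_zero_iff.2 hpV, hT x hx.1 hx.2 p hp hpV hpW⟩
  have hω0 : volume (ball (0 : V) 1) ≠ 0 := (measure_ball_pos _ _ one_pos).ne'
  have hωtop : volume (ball (0 : V) 1) ≠ ∞ := measure_ball_lt_top.ne
  rw [← ENNReal.mul_le_mul_iff_right hω0 hωtop]
  calc volume (ball (0 : V) 1) *
        (ENNReal.ofReal (m ^ q / 2 * a ^ finrank ℝ V * b ^ finrank ℝ Vᗮ) *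
          volume (ball (0 : Vᗮ) 1))
      = ENNReal.ofReal (m ^ q / 2) * volume Q := by
        rw [hQ, volume_box V z ha.le hb.le, ENNReal.ofReal_mul (by positivity),
          ENNReal.ofReal_mul (by positivity)]
        ring
    _ ≤ ENNReal.ofReal (m ^ q / 2) * (2 * volume A) := by gcongr
    _ = ENNReal.ofReal (m ^ q) * volume A := by
        rw [← mul_assoc, ENNReal.ofReal_div_of_pos two_pos, ENNReal.ofReal_ofNat,
          ENNReal.div_mul_cancel two_ne_zero ENNReal.ofNat_ne_top]
    _ ≤ ENNReal.ofReal ((S / a) ^ finrank ℝ V) * volume (ball (0 : V) 1) * volume T :=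
        hlower.trans hupper
    _ = _ := by ring

/-- The box estimate with the crude bound `S / b` on the slopes orthogonal to `V`. -/
lemma IsConvexSubsolution.box_estimate_closedBall {Ω : Set (EuclideanSpace ℝ (Fin n))} {q : ℝ}
    {v : EuclideanSpace ℝ (Fin n) → ℝ} (h : IsConvexSubsolution Ω q v)
    (V : Submodule ℝ (EuclideanSpace ℝ (Fin n))) {z : EuclideanSpace ℝ (Fin n)} {a b m S : ℝ}
    (ha : 0 < a) (hb : 0 < b) (hm : 0 < m) (hΩ : box V z (2 * a) (2 * b) ⊆ Ω)
    (hS : ∀ x ∈ box V z (2 * a) (2 * b), v x ≤ S) (hz : m ≤ v z) :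
    m ^ q / 2 * a ^ finrank ℝ V * b ^ finrank ℝ Vᗮ
      ≤ (S / a) ^ finrank ℝ V * (S / b) ^ finrank ℝ Vᗮ := by
  have hzbox : z ∈ box V z (2 * a) (2 * b) := by simp [box, ha.le, hb.le]
  have hS0 : 0 ≤ S := (h.nonneg z (hΩ hzbox)).trans (hS z hzbox)
  have key := h.box_estimate V ha hb hm hΩ hS hz (closedBall 0 (S / b))
    fun x _ _ p _ _ hp => mem_closedBall_zero_iff.2 hp
  rw [volume_closedBall_eq Vᗮ (by positivity), ← mul_assoc,
    ENNReal.mul_le_mul_iff_left (measure_ball_pos _ _ one_pos).ne' measure_ball_lt_top.ne,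
    ← ENNReal.ofReal_mul (by positivity), ENNReal.ofReal_le_ofReal_iff (by positivity)] at key
  exact key

/-! ### Nondegeneracy and doubling scales -/

lemma IsConvexSubsolution.ball_estimate {Ω : Set (EuclideanSpace ℝ (Fin n))} {q : ℝ}
    {v : EuclideanSpace ℝ (Fin n) → ℝ} (h : IsConvexSubsolution Ω q v)
    {z : EuclideanSpace ℝ (Fin n)} {b m S : ℝ} (hb : 0 < b) (hm : 0 < m)
    (hΩ : closedBall z (2 * b) ⊆ Ω) (hS : ∀ x ∈ closedBall z (2 * b), v x ≤ S) (hz : m ≤ v z) :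
    m ^ q / 2 * b ^ n ≤ (S / b) ^ n := by
  have hsub : box ⊥ z (2 * 1) (2 * b) ⊆ closedBall z (2 * b) := by
    intro x hx
    have h2 := hx.2
    have hmem : x - z ∈ (⊥ : Submodule ℝ (EuclideanSpace ℝ (Fin n)))ᗮ := by
      rw [Submodule.bot_orthogonal_eq_top]; trivial
    rw [Submodule.norm_orthogonalProjectionOnto_apply _ hmem] at h2
    rwa [mem_closedBall, dist_eq_norm]
  have key := h.box_estimate_closedBall ⊥ one_pos hb hm (hsub.trans hΩ)
    (fun x hx => hS x (hsub hx)) hz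
  have hd : finrank ℝ (⊥ : Submodule ℝ (EuclideanSpace ℝ (Fin n)))ᗮ = n := by
    rw [Submodule.bot_orthogonal_eq_top, finrank_top, finrank_euclideanSpace_fin]
  simpa [hd] using key

/-- A ball around `z` of radius large compared with `v z ^ ((n - q) / (2 n))` contains a point where
`v` exceeds `2 * v z`. -/
lemma IsConvexSubsolution.exists_two_mul_lt {Ω : Set (EuclideanSpace ℝ (Fin n))} {q : ℝ}
    {v : EuclideanSpace ℝ (Fin n) → ℝ} (h : IsConvexSubsolution Ω q v) (hqn : q < n)
    {z : EuclideanSpace ℝ (Fin n)} {b : ℝ} (hz : 0 < v z)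
    (hb : 2 * v z ^ ((n - q) / (2 * n)) < b) (hΩ : closedBall z (2 * b) ⊆ Ω) :
    ∃ z' ∈ closedBall z (2 * b), 2 * v z < v z' := by
  by_contra! hcon
  have hn : (0 : ℝ) < n := h.q_nonneg.trans_lt hqn
  have hn1 : 1 ≤ n := by exact_mod_cast hn
  have hpos : 0 < v z ^ ((n - q) / (2 * n)) := Real.rpow_pos_of_pos hz _
  have hb0 : 0 < b := lt_trans (by positivity) hb
  have key := h.ball_estimate hb0 hz hΩ hcon le_rfl
  rw [div_pow, le_div_iff₀ (by positivity), mul_pow] at key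
  have h1 : (2 * v z ^ ((n - q) / (2 * n))) ^ (2 * n) < b ^ (2 * n) :=
    pow_lt_pow_left₀ hb (by positivity) (by omega)
  have h2 : (v z ^ ((n - q) / (2 * n))) ^ (2 * n) * v z ^ q = v z ^ n := by
    rw [← Real.rpow_natCast, ← Real.rpow_mul hz.le, ← Real.rpow_add hz, ← Real.rpow_natCast]
    congr 1
    push_cast
    field_simp
    ring
  have h3 : (2 : ℝ) ^ (n + 1) ≤ 2 ^ (2 * n) := pow_le_pow_right₀ one_le_two (by omega)
  have hvq : 0 < v z ^ q := Real.rpow_pos_of_pos hz _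
  have hvn : 0 < v z ^ n := by positivity
  have h4 : v z ^ q * b ^ (2 * n) ≤ 2 ^ (n + 1) * v z ^ n := by
    rw [two_mul, pow_add, pow_succ]
    nlinarith
  have h5 : v z ^ q * (2 * v z ^ ((n - q) / (2 * n))) ^ (2 * n) = 2 ^ (2 * n) * v z ^ n := by
    rw [mul_pow, ← h2]; ring
  have h6 := mul_lt_mul_of_pos_left h1 hvq
  rw [h5] at h6
  have h7 := mul_le_mul_of_nonneg_right h3 hvn.le
  linarith

/-- Nondegeneracy: around a point where `v` is positive, `v` grows at least like the power
`2 n / (n - q)` of the radius. -/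
lemma IsConvexSubsolution.exists_mul_le_rpow {Ω : Set (EuclideanSpace ℝ (Fin n))} {q : ℝ}
    {v : EuclideanSpace ℝ (Fin n) → ℝ} (h : IsConvexSubsolution Ω q v) (hqn : q < n) :
    ∃ c : ℝ, 0 < c ∧ ∀ (z₀ : EuclideanSpace ℝ (Fin n)) (ρ μ : ℝ), 0 < ρ →
      closedBall z₀ ρ ⊆ Ω → 0 < v z₀ → (∀ x ∈ closedBall z₀ ρ, v x ≤ μ) →
        c * ρ ≤ μ ^ ((n - q) / (2 * n)) := by
  have hn : (0 : ℝ) < n := h.q_nonneg.trans_lt hqn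
  set β : ℝ := (n - q) / (2 * n) with hβ
  have hβ0 : 0 < β := div_pos (by linarith) (by linarith)
  have h2β : 0 < (2 : ℝ) ^ β - 1 := sub_pos.2 (Real.one_lt_rpow one_lt_two hβ0)
  set A : ℝ := 7 / (2 ^ β - 1) with hA
  have hA0 : 0 < A := by positivity
  have hA7 : A * (2 ^ β - 1) = 7 := div_mul_cancel₀ _ h2β.ne'
  refine ⟨1 / (A + 6), by positivity, fun z₀ ρ μ hρ hΩ hz₀ hμ => ?_⟩
  by_contra! hlt
  rw [div_mul_eq_mul_div, one_mul, lt_div_iff₀ (by positivity)] at hlt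
  -- A maximum point of this penalized function cannot see the value of `v` double nearby.
  obtain ⟨z, hz, hmax⟩ := (isCompact_closedBall z₀ ρ).exists_isMaxOn
    (f := fun x => A * v x ^ β - dist x z₀) ⟨z₀, mem_closedBall_self hρ.le⟩
    ((continuousOn_const.mul ((h.continuousOn.mono hΩ).rpow_const fun _ _ => Or.inr hβ0.le)).sub
      (continuous_id.dist continuous_const).continuousOn)
  have hcenter : A * v z₀ ^ β - dist z₀ z₀ ≤ A * v z ^ β - dist z z₀ :=
    hmax (mem_closedBall_self hρ.le)
  rw [dist_self, sub_zero] at hcenter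
  have hz₀β : 0 < A * v z₀ ^ β := mul_pos hA0 (Real.rpow_pos_of_pos hz₀ _)
  have hdist0 : 0 ≤ dist z z₀ := dist_nonneg
  have hvz0 : 0 ≤ v z := h.nonneg z (hΩ hz)
  have hvz : 0 < v z := by
    rcases hvz0.lt_or_eq with hlt' | heq
    · exact hlt'
    · rw [← heq, Real.zero_rpow hβ0.ne'] at hcenter
      linarith
  have hvβ : 0 < v z ^ β := Real.rpow_pos_of_pos hvz _
  have hvμ : v z ^ β ≤ μ ^ β := Real.rpow_le_rpow hvz0 (hμ z hz) hβ0.le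
  have hsub : closedBall z (2 * (3 * v z ^ β)) ⊆ closedBall z₀ ρ := by
    apply closedBall_subset_closedBall'
    nlinarith
  obtain ⟨z', hz', hdouble⟩ := h.exists_two_mul_lt hqn hvz
    (b := 3 * v z ^ β) (by linarith) (hsub.trans hΩ)
  have hz'max : A * v z' ^ β - dist z' z₀ ≤ A * v z ^ β - dist z z₀ := hmax (hsub hz')
  have hpow : 2 ^ β * v z ^ β ≤ v z' ^ β := by
    rw [← Real.mul_rpow zero_le_two hvz0]
    exact Real.rpow_le_rpow (by positivity) hdouble.le hβ0.le
  have htri : dist z' z₀ ≤ dist z' z + dist z z₀ := dist_triangle _ _ _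
  have hz'd : dist z' z ≤ 2 * (3 * v z ^ β) := hz'
  have hApow := mul_le_mul_of_nonneg_left hpow hA0.le
  have hexp : A * (2 ^ β * v z ^ β) = A * (2 ^ β - 1) * v z ^ β + A * v z ^ β := by ring
  rw [hexp, hA7] at hApow
  linarith

/-- A function bounded below by the power `N` of the radius cannot drop by more than the factor
`8 ^ (-(N + 1))` at every division of the radius by `8`. -/
lemma exists_le_apply_div_eight {M : ℝ → ℝ} {c N ρ K : ℝ} (hc : 0 < c) (hρ : 0 < ρ)
    (hM : ∀ ε, 0 < ε → ε ≤ ρ → c * ε ^ N ≤ M ε) (hK : ∀ ε, 0 < ε → ε ≤ ρ → M ε ≤ K) :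
    ∃ ε, 0 < ε ∧ ε ≤ ρ ∧ (8 : ℝ) ^ (-(N + 1)) * M ε ≤ M (ε / 8) := by
  by_contra! hcon
  set θ : ℝ := (8 : ℝ) ^ (-(N + 1)) with hθ
  have hθ0 : 0 < θ := Real.rpow_pos_of_pos (by norm_num) _
  have hθ8 : 8 * θ = (8 : ℝ) ^ (-N) := by
    rw [hθ, neg_add, Real.rpow_add (by norm_num), Real.rpow_neg_one]
    ring
  have hsmall : ∀ j : ℕ, ρ / 8 ^ j ≤ ρ := fun j =>
    div_le_self hρ.le (one_le_pow₀ (by norm_num))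
  have hiter : ∀ j : ℕ, M (ρ / 8 ^ j) ≤ θ ^ j * K := by
    intro j
    induction j with
    | zero => simpa using hK ρ hρ le_rfl
    | succ j ih =>
      have h1 := hcon (ρ / 8 ^ j) (by positivity) (hsmall j)
      rw [div_div, ← pow_succ] at h1
      calc M (ρ / 8 ^ (j + 1)) ≤ θ * M (ρ / 8 ^ j) := h1.le
        _ ≤ θ * (θ ^ j * K) := by gcongr
        _ = θ ^ (j + 1) * K := by ring
  have hbound : ∀ j : ℕ, c * ρ ^ N * 8 ^ j ≤ K := by
    intro j
    have h1 := (hM (ρ / 8 ^ j) (by positivity) (hsmall j)).trans (hiter j)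
    have h2 : (ρ / 8 ^ j) ^ N = ρ ^ N * (8 * θ) ^ j := by
      rw [hθ8, Real.div_rpow hρ.le (by positivity), div_eq_mul_inv,
        ← Real.rpow_natCast, ← Real.rpow_natCast, ← Real.rpow_mul (by norm_num),
        ← Real.rpow_mul (by norm_num), ← Real.rpow_neg (by norm_num)]
      congr 2
      ring
    rw [h2, mul_pow] at h1
    have h3 : θ ^ j * (c * ρ ^ N * 8 ^ j) ≤ θ ^ j * K := by linarith
    exact le_of_mul_le_mul_left h3 (by positivity)
  have hcρ : 0 < c * ρ ^ N := mul_pos hc (Real.rpow_pos_of_pos hρ _)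
  obtain ⟨j, hj⟩ := pow_unbounded_of_one_lt (K / (c * ρ ^ N)) (by norm_num : (1 : ℝ) < 8)
  rw [div_lt_iff₀ hcρ] at hj
  linarith [hbound j]

/-- Near a boundary point of the coincidence set there are arbitrarily small balls on which `v`
has comparable suprema over the ball and over the concentric ball of an eighth of its radius. -/
lemma IsConvexSubsolution.exists_doubling_radius {Ω : Set (EuclideanSpace ℝ (Fin n))} {q : ℝ}
    {v : EuclideanSpace ℝ (Fin n) → ℝ} (h : IsConvexSubsolution Ω q v) (hqn : q < n)
    {x₁ : EuclideanSpace ℝ (Fin n)} (hx₁ : x₁ ∈ Ω)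
    (hpos : ∀ ε > 0, ∃ z ∈ closedBall x₁ ε, 0 < v z) :
    ∃ θ : ℝ, 0 < θ ∧ ∀ δ > 0, ∃ ε, 0 < ε ∧ ε ≤ δ ∧ closedBall x₁ ε ⊆ Ω ∧
      ∃ y ∈ closedBall x₁ ε, 0 < v y ∧ (∀ x ∈ closedBall x₁ ε, v x ≤ v y) ∧
        ∃ z ∈ closedBall x₁ (ε / 8), θ * v y ≤ v z := by
  have hn : (0 : ℝ) < n := h.q_nonneg.trans_lt hqn
  set β : ℝ := (n - q) / (2 * n) with hβ
  have hβ0 : 0 < β := div_pos (by linarith) (by linarith)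
  obtain ⟨c, hc, hnd⟩ := h.exists_mul_le_rpow hqn
  refine ⟨(8 : ℝ) ^ (-(1 / β + 1)), Real.rpow_pos_of_pos (by norm_num) _, fun δ hδ => ?_⟩
  obtain ⟨ρ₀, hρ₀, hball⟩ := nhds_basis_closedBall.mem_iff.1 (h.isOpen.mem_nhds hx₁)
  set ρ := min ρ₀ δ with hρdef
  have hρ : 0 < ρ := lt_min hρ₀ hδ
  have hsub : ∀ ε, ε ≤ ρ → closedBall x₁ ε ⊆ Ω := fun ε hε =>
    (closedBall_subset_closedBall (hε.trans (min_le_left _ _))).trans hball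
  have hmaxex : ∀ ε, ∃ y, 0 < ε → ε ≤ ρ →
      y ∈ closedBall x₁ ε ∧ ∀ x ∈ closedBall x₁ ε, v x ≤ v y := by
    intro ε
    by_cases hε : 0 < ε ∧ ε ≤ ρ
    · obtain ⟨y, hy, hmax⟩ := (isCompact_closedBall x₁ ε).exists_isMaxOn
        ⟨x₁, mem_closedBall_self hε.1.le⟩ (h.continuousOn.mono (hsub ε hε.2))
      exact ⟨y, fun _ _ => ⟨hy, fun x hx => hmax hx⟩⟩
    · exact ⟨x₁, fun h1 h2 => absurd ⟨h1, h2⟩ hε⟩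
  choose Y hY using hmaxex
  have hlow : ∀ ε, 0 < ε → ε ≤ ρ → (c / 2) ^ (1 / β) * ε ^ (1 / β) ≤ v (Y ε) := by
    intro ε hε hερ
    obtain ⟨z₀, hz₀, hz₀pos⟩ := hpos (ε / 2) (by positivity)
    have hz₀sub : closedBall z₀ (ε / 2) ⊆ closedBall x₁ ε := by
      apply closedBall_subset_closedBall'
      linarith [mem_closedBall.1 hz₀]
    have h1 := hnd z₀ (ε / 2) (v (Y ε)) (by positivity) (hz₀sub.trans (hsub ε hερ)) hz₀pos
      fun x hx => (hY ε hε hερ).2 x (hz₀sub hx)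
    have hY0 : 0 ≤ v (Y ε) := h.nonneg _ (hsub ε hερ (hY ε hε hερ).1)
    rw [← Real.mul_rpow (by positivity) hε.le]
    calc (c / 2 * ε) ^ (1 / β) ≤ (v (Y ε) ^ β) ^ (1 / β) :=
          Real.rpow_le_rpow (by positivity) (by linarith) (by positivity)
      _ = v (Y ε) := by rw [← Real.rpow_mul hY0, mul_one_div_cancel hβ0.ne', Real.rpow_one]
  obtain ⟨ε, hε, hερ, hdoub⟩ := exists_le_apply_div_eight (M := fun ε => v (Y ε)) (K := v (Y ρ))
    (c := (c / 2) ^ (1 / β)) (N := 1 / β) (Real.rpow_pos_of_pos (by positivity) _) hρ hlow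
    fun ε hε hερ => (hY ρ hρ le_rfl).2 _ (closedBall_subset_closedBall hερ (hY ε hε hερ).1)
  refine ⟨ε, hε, hερ.trans (min_le_right _ _), hsub ε hερ, Y ε, (hY ε hε hερ).1, ?_,
    (hY ε hε hερ).2, Y (ε / 8), (hY (ε / 8) (by positivity) (by linarith)).1, hdoub⟩
  exact lt_of_lt_of_le (mul_pos (Real.rpow_pos_of_pos (by positivity) _)
    (Real.rpow_pos_of_pos hε _)) (hlow ε hε hερ)

/-! ### Growth at flat points -/

/-- `v` vanishes on the relative ball of radius `r` around `x₁` in direction `V`, but not on any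
neighbourhood of `x₁`. -/
structure IsFlatPoint (Ω : Set (EuclideanSpace ℝ (Fin n))) (v : EuclideanSpace ℝ (Fin n) → ℝ)
    (V : Submodule ℝ (EuclideanSpace ℝ (Fin n))) (x₁ : EuclideanSpace ℝ (Fin n)) (r : ℝ) :
    Prop where
  radius_pos : 0 < r
  flat : ∀ w ∈ V, ‖w‖ ≤ r → x₁ + w ∈ Ω ∧ v (x₁ + w) = 0
  exists_pos : ∀ ε > 0, ∃ z ∈ closedBall x₁ ε, 0 < v z

lemma IsFlatPoint.mem {Ω : Set (EuclideanSpace ℝ (Fin n))} {v : EuclideanSpace ℝ (Fin n) → ℝ}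
    {V : Submodule ℝ (EuclideanSpace ℝ (Fin n))} {x₁ : EuclideanSpace ℝ (Fin n)} {r : ℝ}
    (hf : IsFlatPoint Ω v V x₁ r) : x₁ ∈ Ω := by
  simpa using (hf.flat 0 V.zero_mem (by simpa using hf.radius_pos.le)).1

lemma IsFlatPoint.apply_eq_zero {Ω : Set (EuclideanSpace ℝ (Fin n))}
    {v : EuclideanSpace ℝ (Fin n) → ℝ} {V : Submodule ℝ (EuclideanSpace ℝ (Fin n))}
    {x₁ : EuclideanSpace ℝ (Fin n)} {r : ℝ} (hf : IsFlatPoint Ω v V x₁ r) : v x₁ = 0 := by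
  simpa using (hf.flat 0 V.zero_mem (by simpa using hf.radius_pos.le)).2

/-- A point of the box is the midpoint of a point of the flat piece and a point displaced from
`x₁` orthogonally to `V`, so convexity bounds `v` on the box by its values on a small ball. -/
lemma IsConvexSubsolution.mem_and_le_of_mem_box {Ω : Set (EuclideanSpace ℝ (Fin n))} {q : ℝ}
    {v : EuclideanSpace ℝ (Fin n) → ℝ} (h : IsConvexSubsolution Ω q v)
    {V : Submodule ℝ (EuclideanSpace ℝ (Fin n))} {x₁ : EuclideanSpace ℝ (Fin n)} {r : ℝ}
    (hf : IsFlatPoint Ω v V x₁ r) {ε S : ℝ} (hΩ : closedBall x₁ ε ⊆ Ω)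
    (hS : ∀ x ∈ closedBall x₁ ε, v x ≤ S) {x : EuclideanSpace ℝ (Fin n)}
    (hx : x ∈ box V x₁ (r / 2) (ε / 2)) : x ∈ Ω ∧ v x ≤ S / 2 := by
  obtain ⟨hw, hy⟩ := hx
  have hdec := V.starProjection_add_starProjection_orthogonal (x - x₁)
  rw [Submodule.starProjection_apply, Submodule.starProjection_apply] at hdec
  set w : V := V.orthogonalProjectionOnto (x - x₁)
  set y : Vᗮ := Vᗮ.orthogonalProjectionOnto (x - x₁)
  rw [Submodule.coe_norm] at hw hy
  have hx' : x = (1 / 2 : ℝ) • (x₁ + (2 : ℝ) • (w : EuclideanSpace ℝ (Fin n)))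
      + (1 / 2 : ℝ) • (x₁ + (2 : ℝ) • (y : EuclideanSpace ℝ (Fin n))) := by
    rw [← sub_add_cancel x x₁, ← hdec]
    module
  obtain ⟨h1, h2⟩ := hf.flat ((2 : ℝ) • (w : EuclideanSpace ℝ (Fin n)))
    (V.smul_mem _ w.2) (by rw [norm_smul, Real.norm_ofNat]; linarith)
  have h3 : x₁ + (2 : ℝ) • (y : EuclideanSpace ℝ (Fin n)) ∈ closedBall x₁ ε := by
    rw [mem_closedBall, dist_eq_norm, add_sub_cancel_left, norm_smul, Real.norm_ofNat]
    linarith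
  have hmem := h.convexOn.1 h1 (hΩ h3) (one_half_pos (α := ℝ)).le
    (one_half_pos (α := ℝ)).le (add_halves (1 : ℝ))
  have hle := h.convexOn.2 h1 (hΩ h3) (one_half_pos (α := ℝ)).le
    (one_half_pos (α := ℝ)).le (add_halves (1 : ℝ))
  rw [← hx'] at hmem hle
  rw [h2, smul_eq_mul, smul_eq_mul, mul_zero, zero_add] at hle
  exact ⟨hmem, by linarith [hS _ h3]⟩

/-- Arbitrarily small scales `ε` at which the box estimate applies with upper bound
`S = max v` over the ball of radius `ε` and lower bound `θ S`. -/
lemma IsConvexSubsolution.exists_box_scale {Ω : Set (EuclideanSpace ℝ (Fin n))} {q : ℝ}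
    {v : EuclideanSpace ℝ (Fin n) → ℝ} (h : IsConvexSubsolution Ω q v) (hqn : q < n)
    {V : Submodule ℝ (EuclideanSpace ℝ (Fin n))} {x₁ : EuclideanSpace ℝ (Fin n)} {r : ℝ}
    (hf : IsFlatPoint Ω v V x₁ r) :
    ∃ θ : ℝ, 0 < θ ∧ ∀ δ > 0, ∃ (ε S : ℝ) (y z : EuclideanSpace ℝ (Fin n)), 0 < ε ∧ ε ≤ δ ∧ 0 < S ∧
      y ∈ Ω ∧ dist y x₁ ≤ ε ∧ v y = S ∧ θ * S ≤ v z ∧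
      box V z (2 * (r / 8)) (2 * (ε / 16)) ⊆ Ω ∧
      (∀ x ∈ box V z (2 * (r / 8)) (2 * (ε / 16)), v x ≤ S) ∧
      box V z (r / 8) (ε / 16) ⊆ box V x₁ (r / 2) ε := by
  obtain ⟨θ, hθ, hscale⟩ := h.exists_doubling_radius hqn hf.mem hf.exists_pos
  have hr := hf.radius_pos
  refine ⟨θ, hθ, fun δ hδ => ?_⟩
  obtain ⟨ε, hε, hεδ, hball, y, hy, hypos, hmax, z, hz, hθz⟩ :=
    hscale (min δ r) (lt_min hδ hr)
  have hεr : ε ≤ r := hεδ.trans (min_le_right _ _)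
  have hbox : box V z (2 * (r / 8)) (2 * (ε / 16)) ⊆ box V x₁ (r / 2) (ε / 2) := by
    intro x hx
    have hz' : ‖z - x₁‖ ≤ ε / 8 := by rwa [← dist_eq_norm]
    have hsplit : x - x₁ = (x - z) + (z - x₁) := by abel
    have h1 := V.norm_orthogonalProjectionOnto_apply_le (z - x₁)
    have h2 := Vᗮ.norm_orthogonalProjectionOnto_apply_le (z - x₁)
    simp only [box, mem_ofPred_eq, hsplit, map_add]
    exact ⟨(norm_add_le _ _).trans (by linarith [hx.1]),
      (norm_add_le _ _).trans (by linarith [hx.2])⟩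
  have hmem : ∀ x ∈ box V z (2 * (r / 8)) (2 * (ε / 16)), x ∈ Ω ∧ v x ≤ v y / 2 :=
    fun x hx => h.mem_and_le_of_mem_box hf hball hmax (hbox hx)
  exact ⟨ε, v y, y, z, hε, hεδ.trans (min_le_left _ _), hypos, hball hy, hy, rfl, hθz,
    fun x hx => (hmem x hx).1, fun x hx => (hmem x hx).2.trans (by linarith),
    (box_subset_box V z (by linarith) (by linarith)).trans
      (hbox.trans (box_subset_box V x₁ le_rfl (by linarith)))⟩

lemma finrank_add_finrank_orthogonal_eq (V : Submodule ℝ (EuclideanSpace ℝ (Fin n))) :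
    finrank ℝ V + finrank ℝ Vᗮ = n := by
  rw [V.finrank_add_finrank_orthogonal, finrank_euclideanSpace_fin]

/-- If `v` grows at most like the power `s` of the distance to a flat point, then the box estimate
bounds `s` in terms of the codimension of the flat piece. -/
lemma IsConvexSubsolution.mul_le_two_mul_finrank_orthogonal
    {Ω : Set (EuclideanSpace ℝ (Fin n))} {q : ℝ}
    {v : EuclideanSpace ℝ (Fin n) → ℝ} (h : IsConvexSubsolution Ω q v) (hqn : q < n)
    {V : Submodule ℝ (EuclideanSpace ℝ (Fin n))} {x₁ : EuclideanSpace ℝ (Fin n)} {r : ℝ}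
    (hf : IsFlatPoint Ω v V x₁ r) {C s ρ : ℝ} (hC : 0 < C) (hs : 0 ≤ s) (hρ : 0 < ρ)
    (hgrowth : ∀ x ∈ Ω, dist x x₁ ≤ ρ → v x ≤ C * dist x x₁ ^ s) :
    s * (n - q) ≤ 2 * finrank ℝ Vᗮ := by
  by_contra! hlt
  obtain ⟨θ, hθ, hscale⟩ := h.exists_box_scale hqn hf
  have hr := hf.radius_pos
  have hnq : 0 < n - q := sub_pos.2 hqn
  have hkd := finrank_add_finrank_orthogonal_eq V
  set k := finrank ℝ V with hk
  set d := finrank ℝ Vᗮ with hd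
  set t : ℝ := s * (n - q) - 2 * d with ht
  have ht0 : 0 < t := sub_pos.2 hlt
  set κ : ℝ := θ ^ q / 2 * ((r / 8) ^ k) ^ 2 / (16 ^ d) ^ 2 with hκ
  have hθq : 0 < θ ^ q := Real.rpow_pos_of_pos hθ _
  have hκ0 : 0 < κ := by positivity
  have hCnq : 0 < C ^ (n - q) := Real.rpow_pos_of_pos hC _
  -- At scales below `δ` the growth bound gives `S ^ (n - q) ≤ κ / 2 * ε ^ (2 d)`, against the
  -- lower bound `κ * ε ^ (2 d)` from the box estimate.
  set δ : ℝ := (κ / (2 * C ^ (n - q))) ^ (1 / t) with hδ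
  have hδ0 : 0 < δ := Real.rpow_pos_of_pos (by positivity) _
  obtain ⟨ε, S, y, z, hε, hεδ, hS0, hyΩ, hyε, hvy, hθz, hbΩ, hbS, -⟩ :=
    hscale (min δ ρ) (lt_min hδ0 hρ)
  have key := h.box_estimate_closedBall V (by positivity) (by positivity) (by positivity)
    hbΩ hbS hθz
  have hSε : S ≤ C * ε ^ s := by
    rw [← hvy]
    refine (hgrowth y hyΩ (hyε.trans (hεδ.trans (min_le_right _ _)))).trans ?_
    gcongr
  have hSq : 0 < S ^ q := Real.rpow_pos_of_pos hS0 _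
  have hεt0 : 0 < ε ^ t := Real.rpow_pos_of_pos hε _
  have hSn : S ^ k * S ^ d = S ^ q * S ^ ((n : ℝ) - q) := by
    rw [← pow_add, hkd, ← Real.rpow_add hS0, ← Real.rpow_natCast]
    congr 1
    ring
  have hκε : κ * (ε ^ d) ^ 2 ≤ S ^ ((n : ℝ) - q) := by
    rw [← hk, ← hd, Real.mul_rpow hθ.le hS0.le] at key
    simp only [div_pow S, div_pow ε] at key
    rw [div_mul_div_comm, hSn, le_div_iff₀ (by positivity)] at key
    have h1 : S ^ q * (κ * (ε ^ d) ^ 2) ≤ S ^ q * S ^ ((n : ℝ) - q) := by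
      refine le_trans (le_of_eq ?_) key
      rw [hκ]
      field_simp
    exact le_of_mul_le_mul_left h1 hSq
  have hSpow : S ^ ((n : ℝ) - q) ≤ C ^ (n - q) * ((ε ^ d) ^ 2 * ε ^ t) := by
    refine (Real.rpow_le_rpow hS0.le hSε hnq.le).trans (le_of_eq ?_)
    rw [Real.mul_rpow hC.le (Real.rpow_nonneg hε.le _), ← Real.rpow_mul hε.le]
    congr 1
    rw [← pow_mul, ← Real.rpow_natCast, ← Real.rpow_add hε]
    congr 1
    rw [ht]
    push_cast
    ring
  have hκt : κ ≤ C ^ (n - q) * ε ^ t := by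
    have h1 : (ε ^ d) ^ 2 * κ ≤ (ε ^ d) ^ 2 * (C ^ (n - q) * ε ^ t) := by linarith
    exact le_of_mul_le_mul_left h1 (by positivity)
  have hεt : ε ^ t ≤ κ / (2 * C ^ (n - q)) := by
    calc ε ^ t ≤ δ ^ t := Real.rpow_le_rpow hε.le (hεδ.trans (min_le_left _ _)) ht0.le
      _ = κ / (2 * C ^ (n - q)) := by
        rw [hδ, ← Real.rpow_mul (by positivity), one_div_mul_cancel ht0.ne', Real.rpow_one]
  have h2 : C ^ (n - q) * ε ^ t ≤ C ^ (n - q) * (κ / (2 * C ^ (n - q))) :=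
    mul_le_mul_of_nonneg_left hεt hCnq.le
  have h3 : C ^ (n - q) * (κ / (2 * C ^ (n - q))) = κ / 2 := by field_simp
  linarith

/-! ### Slopes near flat points -/

lemma IsConvexSubsolution.exists_le_mul_dist {Ω : Set (EuclideanSpace ℝ (Fin n))} {q : ℝ}
    {v : EuclideanSpace ℝ (Fin n) → ℝ} (h : IsConvexSubsolution Ω q v)
    {x₁ : EuclideanSpace ℝ (Fin n)} (hx₁ : x₁ ∈ Ω) (hv : v x₁ = 0) :
    ∃ Λ ρ : ℝ, 0 < Λ ∧ 0 < ρ ∧ closedBall x₁ ρ ⊆ Ω ∧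
      ∀ x, dist x x₁ ≤ ρ → v x ≤ Λ * dist x x₁ := by
  obtain ⟨K, t, ht, hK⟩ := h.convexOn.locallyLipschitzOn h.isOpen hx₁
  rw [h.isOpen.nhdsWithin_eq hx₁] at ht
  obtain ⟨ρ, hρ, hball⟩ := nhds_basis_closedBall.mem_iff.1
    (Filter.inter_mem ht (h.isOpen.mem_nhds hx₁))
  refine ⟨K + 1, ρ, by positivity, hρ, hball.trans inter_subset_right, fun x hx => ?_⟩
  have h1 := hK.dist_le_mul x (hball hx).1 x₁ (hball (mem_closedBall_self hρ.le)).1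
  rw [hv, Real.dist_eq, sub_zero] at h1
  have h2 : 0 ≤ dist x x₁ := dist_nonneg
  linarith [le_abs_self (v x)]

/-- The components orthogonal to `V` of the slopes of affine functions through `(x₁, 0)` lying
below `v + η`. For `η = 0` this is the subdifferential at a flat point. -/
def slopeSet (Ω : Set (EuclideanSpace ℝ (Fin n))) (v : EuclideanSpace ℝ (Fin n) → ℝ)
    (V : Submodule ℝ (EuclideanSpace ℝ (Fin n))) (x₁ : EuclideanSpace ℝ (Fin n)) (η : ℝ) :
    Set Vᗮ :=
  {u | ∀ y ∈ Ω, inner ℝ (u : EuclideanSpace ℝ (Fin n)) (y - x₁) ≤ v y + η}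

lemma isClosed_slopeSet (Ω : Set (EuclideanSpace ℝ (Fin n))) (v : EuclideanSpace ℝ (Fin n) → ℝ)
    (V : Submodule ℝ (EuclideanSpace ℝ (Fin n))) (x₁ : EuclideanSpace ℝ (Fin n)) (η : ℝ) :
    IsClosed (slopeSet Ω v V x₁ η) := by
  have : slopeSet Ω v V x₁ η = ⋂ y ∈ Ω,
      {u : Vᗮ | inner ℝ (u : EuclideanSpace ℝ (Fin n)) (y - x₁) ≤ v y + η} := by
    ext u
    simp [slopeSet]
  rw [this]
  exact isClosed_biInter fun y _ => isClosed_le (by fun_prop) continuous_const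

lemma convex_slopeSet (Ω : Set (EuclideanSpace ℝ (Fin n))) (v : EuclideanSpace ℝ (Fin n) → ℝ)
    (V : Submodule ℝ (EuclideanSpace ℝ (Fin n))) (x₁ : EuclideanSpace ℝ (Fin n)) (η : ℝ) :
    Convex ℝ (slopeSet Ω v V x₁ η) := by
  intro u hu u' hu' a b ha hb hab y hy
  have h1 := mul_le_mul_of_nonneg_left (hu y hy) ha
  have h2 := mul_le_mul_of_nonneg_left (hu' y hy) hb
  rw [Submodule.coe_add, Submodule.coe_smul, Submodule.coe_smul, inner_add_left,
    real_inner_smul_left, real_inner_smul_left]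
  calc _ ≤ a * (v y + η) + b * (v y + η) := add_le_add h1 h2
    _ = v y + η := by rw [← add_mul, hab, one_mul]

/-- The slopes that are admissible up to an error `η` but are not interior among the exactly
admissible ones fill a set whose measure tends to `0` with `η`, since the boundary of a convex set
is null. -/
lemma IsConvexSubsolution.exists_volume_slopeSet_sdiff_lt
    {Ω : Set (EuclideanSpace ℝ (Fin n))} {q : ℝ}
    {v : EuclideanSpace ℝ (Fin n) → ℝ} (h : IsConvexSubsolution Ω q v)
    (V : Submodule ℝ (EuclideanSpace ℝ (Fin n))) {x₁ : EuclideanSpace ℝ (Fin n)} (hx₁ : x₁ ∈ Ω)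
    (hv : v x₁ = 0) {m : ℝ≥0∞} (hm : 0 < m) :
    ∃ η : ℝ, 0 < η ∧
      volume (slopeSet Ω v V x₁ η \ interior (slopeSet Ω v V x₁ 0)) < m := by
  obtain ⟨Λ, ρ, hΛ, hρ, hball, hlin⟩ := h.exists_le_mul_dist hx₁ hv
  set T : ℕ → Set Vᗮ := fun j =>
    slopeSet Ω v V x₁ (1 / ((j : ℝ) + 1)) \ interior (slopeSet Ω v V x₁ 0)
  have hTmeas : ∀ j, NullMeasurableSet (T j) volume := fun j =>
    ((isClosed_slopeSet Ω v V x₁ _).measurableSet.diff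
      isOpen_interior.measurableSet).nullMeasurableSet
  have hTanti : Antitone T := by
    intro i j hij u hu
    refine ⟨fun y hy => (hu.1 y hy).trans ?_, hu.2⟩
    gcongr
  have hTfin : volume (T 0) ≠ ∞ := by
    refine ne_top_of_le_ne_top (measure_closedBall_lt_top (x := (0 : Vᗮ))
      (r := (Λ * ρ + 1) / ρ)).ne (measure_mono fun u hu => ?_)
    have h1 : ‖Vᗮ.orthogonalProjectionOnto (u : EuclideanSpace ℝ (Fin n))‖
        ≤ (Λ * ρ + 1) / ρ := by
      refine norm_le_div_of_forall_inner_le hρ (by positivity) fun w _ hw => ?_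
      have hd : dist (x₁ + w) x₁ ≤ ρ := by rwa [dist_eq_norm, add_sub_cancel_left]
      have h2 := hu.1 (x₁ + w) (hball hd)
      have h3 := hlin _ hd
      have h4 := mul_le_mul_of_nonneg_left hd hΛ.le
      rw [add_sub_cancel_left] at h2
      norm_num at h2
      linarith
    rwa [Submodule.orthogonalProjectionOnto_mem_subspace_eq_self, ← mem_closedBall_zero_iff] at h1
  have hinter : volume (⋂ j, T j) = 0 := by
    refine measure_mono_null (fun u hu => ?_)
      ((convex_slopeSet Ω v V x₁ 0).addHaar_frontier volume)
    rw [mem_iInter] at hu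
    refine ⟨subset_closure fun y hy => ?_, (hu 0).2⟩
    have hlim : Filter.Tendsto (fun j : ℕ => v y + 1 / ((j : ℝ) + 1)) Filter.atTop
        (nhds (v y + 0)) := tendsto_one_div_add_atTop_nhds_zero_nat.const_add _
    exact ge_of_tendsto' hlim fun j => (hu j).1 y hy
  have htend := tendsto_measure_iInter_atTop hTmeas hTanti ⟨0, hTfin⟩
  rw [hinter] at htend
  obtain ⟨j, hj⟩ := (htend.eventually (gt_mem_nhds hm)).exists
  exact ⟨1 / ((j : ℝ) + 1), by positivity, hj⟩

/-- Slopes at points near the flat piece are admissible at `x₁` up to a small error. -/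
lemma projection_mem_slopeSet {Ω : Set (EuclideanSpace ℝ (Fin n))}
    {v : EuclideanSpace ℝ (Fin n) → ℝ} {V : Submodule ℝ (EuclideanSpace ℝ (Fin n))}
    {x₁ x p : EuclideanSpace ℝ (Fin n)} {a b R P P' : ℝ} (hP' : 0 ≤ P')
    (hR : ∀ y ∈ Ω, ‖y - x₁‖ ≤ R)
    (hx : x ∈ box V x₁ a b) (hvx : 0 ≤ v x) (hp : p ∈ subdifferential Ω v x)
    (hpV : ‖V.orthogonalProjectionOnto p‖ ≤ P) (hpW : ‖Vᗮ.orthogonalProjectionOnto p‖ ≤ P') :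
    Vᗮ.orthogonalProjectionOnto p ∈ slopeSet Ω v V x₁ (P * (a + R) + P' * b) := by
  intro y hy
  obtain ⟨hw, hz⟩ := hx
  have hxdec := V.starProjection_add_starProjection_orthogonal (x - x₁)
  have hpdec := V.starProjection_add_starProjection_orthogonal p
  rw [Submodule.starProjection_apply, Submodule.starProjection_apply] at hxdec hpdec
  set w : V := V.orthogonalProjectionOnto (x - x₁)
  set z : Vᗮ := Vᗮ.orthogonalProjectionOnto (x - x₁)
  set p' : V := V.orthogonalProjectionOnto p
  set u : Vᗮ := Vᗮ.orthogonalProjectionOnto p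
  have hslope := hp y hy
  have hyx : y - x = (y - x₁) - (x - x₁) := by abel
  have hwu : inner ℝ (u : EuclideanSpace ℝ (Fin n)) (w : EuclideanSpace ℝ (Fin n)) = 0 :=
    Submodule.inner_left_of_mem_orthogonal w.2 u.2
  have hzp : inner ℝ (p' : EuclideanSpace ℝ (Fin n)) (z : EuclideanSpace ℝ (Fin n)) = 0 :=
    Submodule.inner_right_of_mem_orthogonal p'.2 z.2
  rw [hyx, inner_sub_right, ← hxdec, ← hpdec, inner_add_left, inner_add_left, inner_add_right,
    inner_add_right, hwu, hzp] at hslope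
  have h1 : inner ℝ (p' : EuclideanSpace ℝ (Fin n)) (w : EuclideanSpace ℝ (Fin n)) ≤ P * a :=
    (real_inner_le_norm _ _).trans
      (mul_le_mul hpV hw (norm_nonneg _) ((norm_nonneg _).trans hpV))
  have h2 : inner ℝ (u : EuclideanSpace ℝ (Fin n)) (z : EuclideanSpace ℝ (Fin n)) ≤ P' * b :=
    (real_inner_le_norm _ _).trans (mul_le_mul hpW hz (norm_nonneg _) hP')
  have h3 : -inner ℝ (p' : EuclideanSpace ℝ (Fin n)) (y - x₁) ≤ P * R := by
    rw [← inner_neg_left]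
    refine (real_inner_le_norm _ _).trans ?_
    rw [norm_neg]
    exact mul_le_mul hpV (hR y hy) (norm_nonneg _) ((norm_nonneg _).trans hpV)
  linarith

/-- A slope of `v` at a point where `v` is positive is never interior among the slopes at the flat
point: the graph there would have to lie strictly above the supporting plane. -/
lemma IsFlatPoint.projection_notMem_interior_slopeSet {Ω : Set (EuclideanSpace ℝ (Fin n))}
    {v : EuclideanSpace ℝ (Fin n) → ℝ} {V : Submodule ℝ (EuclideanSpace ℝ (Fin n))}
    {x₁ x p : EuclideanSpace ℝ (Fin n)} {r b : ℝ} (hf : IsFlatPoint Ω v V x₁ r) (hxΩ : x ∈ Ω)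
    (hx : x ∈ box V x₁ r b) (hvx : 0 < v x) (hp : p ∈ subdifferential Ω v x) :
    Vᗮ.orthogonalProjectionOnto p ∉ interior (slopeSet Ω v V x₁ 0) := by
  intro hint
  have hw := hx.1
  have hxdec := V.starProjection_add_starProjection_orthogonal (x - x₁)
  have hpdec := V.starProjection_add_starProjection_orthogonal p
  rw [Submodule.starProjection_apply, Submodule.starProjection_apply] at hxdec hpdec
  set w : V := V.orthogonalProjectionOnto (x - x₁)
  set z : Vᗮ := Vᗮ.orthogonalProjectionOnto (x - x₁)
  set p' : V := V.orthogonalProjectionOnto p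
  set u : Vᗮ := Vᗮ.orthogonalProjectionOnto p
  obtain ⟨hwΩ, hvw⟩ := hf.flat w w.2 hw
  have hz0 : 0 < ‖(z : EuclideanSpace ℝ (Fin n))‖ := by
    rw [norm_pos_iff]
    intro hz
    rw [hz, add_zero] at hxdec
    rw [hxdec, add_sub_cancel] at hvw
    exact hvx.ne' hvw
  have hwz : ∀ u' : Vᗮ,
      inner ℝ (u' : EuclideanSpace ℝ (Fin n)) (w : EuclideanSpace ℝ (Fin n)) = 0 :=
    fun u' => Submodule.inner_left_of_mem_orthogonal w.2 u'.2
  have hzp : inner ℝ (p' : EuclideanSpace ℝ (Fin n)) (z : EuclideanSpace ℝ (Fin n)) = 0 :=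
    Submodule.inner_right_of_mem_orthogonal p'.2 z.2
  have hslope := hp (x₁ + w) hwΩ
  have hback : x₁ + (w : EuclideanSpace ℝ (Fin n)) - x = -(z : EuclideanSpace ℝ (Fin n)) := by
    rw [← sub_eq_zero, ← sub_eq_zero.2 hxdec]; abel
  rw [hback, hvw, inner_neg_right, ← hpdec, inner_add_left, hzp] at hslope
  have htend : Filter.Tendsto (fun t : ℝ => u + t • z) (nhdsWithin 0 (Ioi 0)) (nhds u) := by
    have hcont : Continuous fun t : ℝ => u + t • z := by fun_prop
    have := (hcont.tendsto 0).mono_left (nhdsWithin_le_nhds (s := Ioi 0))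
    simpa using this
  obtain ⟨t, ht, ht0⟩ := ((htend.eventually (mem_interior_iff_mem_nhds.1 hint)).and
    (self_mem_nhdsWithin (s := Ioi (0 : ℝ)))).exists
  have hx' := ht x hxΩ
  rw [← hxdec, inner_add_right, hwz, Submodule.coe_add, Submodule.coe_smul, inner_add_left,
    real_inner_smul_left, real_inner_self_eq_norm_sq] at hx'
  have ht0' : 0 < t := ht0
  have : 0 < t * ‖(z : EuclideanSpace ℝ (Fin n))‖ ^ 2 := by positivity
  linarith

/-- The critical codimension is excluded: there the box estimate would bound the measure of the
slopes orthogonal to `V` from below, whereas these slopes concentrate on the boundary of the convex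
set of slopes at the flat point. -/
lemma IsConvexSubsolution.two_mul_finrank_orthogonal_ne
    {Ω : Set (EuclideanSpace ℝ (Fin n))} {q : ℝ}
    {v : EuclideanSpace ℝ (Fin n) → ℝ} (h : IsConvexSubsolution Ω q v) (hqn : q < n)
    {V : Submodule ℝ (EuclideanSpace ℝ (Fin n))} {x₁ : EuclideanSpace ℝ (Fin n)} {r : ℝ}
    (hf : IsFlatPoint Ω v V x₁ r) : 2 * (finrank ℝ Vᗮ : ℝ) ≠ n - q := by
  intro hcrit
  obtain ⟨θ, hθ, hscale⟩ := h.exists_box_scale hqn hf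
  obtain ⟨Λ, ρ, hΛ, hρ, -, hlin⟩ := h.exists_le_mul_dist hf.mem hf.apply_eq_zero
  obtain ⟨R, hR⟩ := h.isBounded.subset_closedBall x₁
  have hR' : ∀ y ∈ Ω, ‖y - x₁‖ ≤ R := fun y hy => by
    rw [← dist_eq_norm]; exact hR hy
  have hR0 : 0 ≤ R := (norm_nonneg _).trans (hR' x₁ hf.mem)
  have hr := hf.radius_pos
  have hkd := finrank_add_finrank_orthogonal_eq V
  set k := finrank ℝ V with hk
  set d := finrank ℝ Vᗮ with hd
  have hθq : 0 < θ ^ q := Real.rpow_pos_of_pos hθ _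
  set κ₁ : ℝ := θ ^ q / 2 * (r / 8) ^ k / 16 ^ d with hκ₁
  set κ₂ : ℝ := Λ ^ d / (r / 8) ^ k with hκ₂
  have hκ₁0 : 0 < κ₁ := by positivity
  have hκ₂0 : 0 < κ₂ := by positivity
  have hω : 0 < volume (ball (0 : Vᗮ) 1) := measure_ball_pos _ _ one_pos
  obtain ⟨η, hη, hvol⟩ := h.exists_volume_slopeSet_sdiff_lt V hf.mem hf.apply_eq_zero
    (m := ENNReal.ofReal (κ₁ / κ₂) * volume (ball (0 : Vᗮ) 1))
    (ENNReal.mul_pos (ENNReal.ofReal_pos.2 (by positivity)).ne' hω.ne')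
  set C₀ : ℝ := Λ / (r / 8) * (r / 2 + R) + 16 * Λ with hC₀
  have hC₀0 : 0 < C₀ := by positivity
  obtain ⟨ε, S, y, z, hε, hεδ, hS0, hyΩ, hyε, hvy, hθz, hbΩ, hbS, hbx₁⟩ :=
    hscale (min (η / C₀) ρ) (lt_min (by positivity) hρ)
  have hSε : S ≤ Λ * ε := by
    rw [← hvy]
    refine (hlin y (hyε.trans (hεδ.trans (min_le_right _ _)))).trans ?_
    gcongr
  have hεη : C₀ * ε ≤ η := by
    have := hεδ.trans (min_le_left _ _)
    rwa [le_div_iff₀ hC₀0, mul_comm] at this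
  have hbΩ' : box V z (r / 8) (ε / 16) ⊆ Ω :=
    (box_subset_box V z (by linarith) (by linarith)).trans hbΩ
  have key := h.box_estimate V (a := r / 8) (b := ε / 16) (by positivity) (by positivity)
    (mul_pos hθ hS0) hbΩ hbS hθz
    (slopeSet Ω v V x₁ η \ interior (slopeSet Ω v V x₁ 0)) (by
      intro x hx hmx p hp hpV hpW
      have hvx : 0 < v x := (mul_pos hθ hS0).trans_le hmx
      refine ⟨fun y hy => ?_, hf.projection_notMem_interior_slopeSet (hbΩ' hx)
        (box_subset_box V x₁ (by linarith) le_rfl (hbx₁ hx)) hvx hp⟩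
      have hPV : S / (r / 8) ≤ Λ / (r / 8) * ε := by
        rw [div_mul_eq_mul_div]; gcongr
      have hPW : S / (ε / 16) ≤ 16 * Λ := by
        rw [div_le_iff₀ (by positivity)]; linarith
      have hmem := projection_mem_slopeSet (by positivity) hR'
        (hbx₁ hx) hvx.le hp (hpV.trans hPV) (hpW.trans hPW) y hy
      have hC₀ε : Λ / (r / 8) * ε * (r / 2 + R) + 16 * Λ * ε = C₀ * ε := by
        rw [hC₀]; ring
      linarith)
  rw [← hk, ← hd] at key
  have hSq : 0 < S ^ q := Real.rpow_pos_of_pos hS0 _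
  -- In the critical case `q + d = k`.
  have hSk : S ^ k = S ^ q * S ^ d := by
    rw [← Real.rpow_natCast, ← Real.rpow_natCast, ← Real.rpow_add hS0]
    congr 1
    have : (k : ℝ) + d = n := by exact_mod_cast hkd
    linarith
  set X : ℝ := S ^ q * ε ^ d with hX
  have hX0 : 0 < X := by positivity
  have hleft : (θ * S) ^ q / 2 * (r / 8) ^ k * (ε / 16) ^ d = X * κ₁ := by
    rw [Real.mul_rpow hθ.le hS0.le, div_pow ε, hX, hκ₁]
    ring
  have hright : (S / (r / 8)) ^ k ≤ X * κ₂ := by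
    have h1 : S ^ d ≤ Λ ^ d * ε ^ d := by
      rw [← mul_pow]; gcongr
    rw [div_pow S, hSk, hX, hκ₂, mul_div_assoc', div_le_div_iff_of_pos_right (by positivity)]
    calc S ^ q * S ^ d ≤ S ^ q * (Λ ^ d * ε ^ d) := by gcongr
      _ = S ^ q * ε ^ d * Λ ^ d := by ring
  rw [hleft] at key
  have hchain := calc
    ENNReal.ofReal (X * κ₁) * volume (ball (0 : Vᗮ) 1)
      ≤ ENNReal.ofReal (X * κ₂) *
        volume (slopeSet Ω v V x₁ η \ interior (slopeSet Ω v V x₁ 0)) :=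
          key.trans (by gcongr)
    _ < ENNReal.ofReal (X * κ₂) * (ENNReal.ofReal (κ₁ / κ₂) * volume (ball (0 : Vᗮ) 1)) := by
        refine ENNReal.mul_lt_mul_right ?_ ENNReal.ofReal_ne_top hvol
        exact (ENNReal.ofReal_pos.2 (by positivity)).ne'
    _ = ENNReal.ofReal (X * κ₁) * volume (ball (0 : Vᗮ) 1) := by
        rw [← mul_assoc, ← ENNReal.ofReal_mul (by positivity)]
        congr 2
        field_simp
  exact lt_irrefl _ hchain

/-! ### Convex subsets of the free boundary -/

lemma exists_relative_ball_subset {E : Set (EuclideanSpace ℝ (Fin n))} (hE : Convex ℝ E)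
    (hne : E.Nonempty) : ∃ x ∈ E, ∃ r : ℝ, 0 < r ∧
      ∀ w ∈ (affineSpan ℝ E).direction, ‖w‖ ≤ r → x + w ∈ E := by
  obtain ⟨x, hx⟩ := hne.intrinsicInterior hE
  obtain ⟨y, hy, rfl⟩ := mem_intrinsicInterior.1 hx
  obtain ⟨r, hr, hball⟩ :=
    nhds_basis_closedBall.mem_iff.1 (mem_interior_iff_mem_nhds.1 hy)
  refine ⟨y, hball (mem_closedBall_self hr.le), r, hr, fun w hw hwr => ?_⟩
  have hmem : w +ᵥ (y : EuclideanSpace ℝ (Fin n)) ∈ affineSpan ℝ E :=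
    AffineSubspace.vadd_mem_of_mem_direction hw y.2
  have h1 : (⟨_, hmem⟩ : affineSpan ℝ E) ∈ closedBall y r := by
    rw [mem_closedBall, Subtype.dist_eq, dist_vadd_left]
    exact hwr
  have h2 : w + (y : EuclideanSpace ℝ (Fin n)) ∈ E := hball h1
  rwa [add_comm] at h2

/-- Growth on the boundary propagates along the flat piece. The point `x₂` lies on the extension of
the segment from `x₀` through `x₁` inside the flat piece, and each `x` near `x₁` is projected from
`x₂` to a boundary point `b` close to `x₀`; convexity and `v x₂ = 0` give `v x ≤ v b`. -/
lemma exists_growth_of_frontier {Ω : Set (EuclideanSpace ℝ (Fin n))} (hΩ_open : IsOpen Ω)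
    (hΩ_convex : Convex ℝ Ω) {v : EuclideanSpace ℝ (Fin n) → ℝ}
    (hv_convex : ConvexOn ℝ (closure Ω) v) (hv_nonneg : ∀ x ∈ closure Ω, 0 ≤ v x)
    {V : Submodule ℝ (EuclideanSpace ℝ (Fin n))} {x₀ x₁ : EuclideanSpace ℝ (Fin n)} {r : ℝ}
    (hf : IsFlatPoint Ω v V x₁ r) (hx₀ : x₀ ∈ frontier Ω) (hx₀V : x₀ - x₁ ∈ V) {C s : ℝ}
    (hs : 0 ≤ s) (hC : ∀ x ∈ frontier Ω, v x ≤ C * ‖x - x₀‖ ^ s) :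
    ∃ C' ρ : ℝ, 0 < C' ∧ 0 < ρ ∧ ∀ x ∈ Ω, dist x x₁ ≤ ρ → v x ≤ C' * dist x x₁ ^ s := by
  have hr := hf.radius_pos
  have hx₀Ω : x₀ ∉ Ω := fun hmem => by
    rw [hΩ_open.frontier_eq] at hx₀
    exact hx₀.2 hmem
  set e := x₀ - x₁ with he
  have he0 : 0 < ‖e‖ := by
    rw [norm_pos_iff, he, sub_ne_zero]
    rintro rfl
    exact hx₀Ω hf.mem
  set δ : ℝ := r / ‖e‖ with hδ
  have hδ0 : 0 < δ := by positivity
  set x₂ := x₁ + (-δ) • e with hx₂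
  obtain ⟨hx₂Ω, hvx₂⟩ : x₂ ∈ Ω ∧ v x₂ = 0 := hf.flat _ (V.smul_mem _ hx₀V) (by
    rw [norm_smul, norm_neg, Real.norm_of_nonneg hδ0.le, hδ, div_mul_cancel₀ _ he0.ne'])
  set B : Set (EuclideanSpace ℝ (Fin n)) := (fun y => x₂ + y) ⁻¹' Ω with hB
  have hBconv : Convex ℝ B := hΩ_convex.translate_preimage_right x₂
  have hBnhds : B ∈ nhds 0 := by
    have hcont : Continuous fun y : EuclideanSpace ℝ (Fin n) => x₂ + y := by fun_prop
    exact (hΩ_open.preimage hcont).mem_nhds (by simpa [hB] using hx₂Ω)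
  have hfrontier : ∀ y, gauge B y = 1 ↔ x₂ + y ∈ frontier Ω := by
    intro y
    rw [gauge_eq_one_iff_mem_frontier hBconv hBnhds]
    have : frontier B = (fun y => x₂ + y) ⁻¹' frontier Ω :=
      ((Homeomorph.addLeft x₂).preimage_frontier Ω).symm
    rw [this, mem_preimage]
  obtain ⟨K, hK⟩ := hBconv.lipschitz_gauge hBnhds
  set κ : ℝ := δ / (1 + δ) with hκ
  have hκ0 : 0 < κ := by positivity
  have hx₁₂ : x₁ - x₂ = κ • (x₀ - x₂) := by
    have h1 : x₁ - x₂ = δ • e := by rw [hx₂]; module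
    have h2 : x₀ - x₂ = (1 + δ) • e := by rw [hx₂, he]; module
    rw [h1, h2, smul_smul, hκ, div_mul_cancel₀ _ (by positivity)]
  have hgκ : gauge B (x₁ - x₂) = κ := by
    rw [hx₁₂, gauge_smul_of_nonneg hκ0.le, (hfrontier (x₀ - x₂)).2 (by simpa using hx₀),
      smul_eq_mul, mul_one]
  set L : ℝ := 2 / κ + 2 * K / κ ^ 2 * ‖x₁ - x₂‖ with hL
  have hL0 : 0 < L := by positivity
  refine ⟨|C| * L ^ s + 1, κ / (2 * (K + 1)), by positivity, by positivity, fun x hx hxρ => ?_⟩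
  have hd0 : 0 ≤ dist x x₁ := dist_nonneg
  set γ : ℝ := gauge B (x - x₂) with hγ
  have hγκ : |γ - κ| ≤ K * dist x x₁ := by
    have h1 := hK.dist_le_mul (x - x₂) (x₁ - x₂)
    rwa [hgκ, Real.dist_eq, dist_sub_right] at h1
  have hγhalf : κ / 2 ≤ γ := by
    have h1 : (K + 1) * dist x x₁ ≤ κ / 2 := by
      rw [le_div_iff₀ (by positivity)] at hxρ
      linarith
    linarith [(abs_le.1 hγκ).1]
  have hγ0 : 0 < γ := by linarith
  have hγ1 : γ ≤ 1 := gauge_le_one_of_mem (by simpa [hB] using hx)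
  set b := x₂ + γ⁻¹ • (x - x₂) with hb
  have hbfr : b ∈ frontier Ω := by
    rw [hb, ← hfrontier, gauge_smul_of_nonneg (by positivity), smul_eq_mul, ← hγ,
      inv_mul_cancel₀ hγ0.ne']
  have hbcl : b ∈ closure Ω := frontier_subset_closure hbfr
  have hvxb : v x ≤ v b := by
    have h1 := hv_convex.2 (subset_closure hx₂Ω) hbcl (sub_nonneg.2 hγ1) hγ0.le
      (sub_add_cancel 1 γ)
    have h2 : (1 - γ) • x₂ + γ • b = x := by
      rw [hb, smul_add γ, smul_smul γ, mul_inv_cancel₀ hγ0.ne']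
      module
    rw [h2, hvx₂, smul_eq_mul, smul_eq_mul, mul_zero, zero_add] at h1
    exact h1.trans (mul_le_of_le_one_left (hv_nonneg b hbcl) hγ1)
  have hbx₀ : ‖b - x₀‖ ≤ L * dist x x₁ := by
    have h1 : b - x₀ = γ⁻¹ • (x - x₁) + (γ⁻¹ - κ⁻¹) • (x₁ - x₂) := by
      have h2 : x₀ = x₂ + κ⁻¹ • (x₁ - x₂) := by
        rw [hx₁₂, smul_smul, inv_mul_cancel₀ hκ0.ne']
        module
      rw [hb]
      nth_rw 1 [h2]
      module
    have hγinv : γ⁻¹ ≤ 2 / κ := by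
      rw [inv_le_comm₀ hγ0 (by positivity), inv_div]
      exact hγhalf
    have hdiff : |γ⁻¹ - κ⁻¹| ≤ 2 * K / κ ^ 2 * dist x x₁ := by
      have h3 : γ⁻¹ - κ⁻¹ = (κ - γ) * (γ⁻¹ * κ⁻¹) := by field_simp
      rw [h3, abs_mul, abs_sub_comm, abs_of_pos (by positivity : 0 < γ⁻¹ * κ⁻¹)]
      calc |γ - κ| * (γ⁻¹ * κ⁻¹) ≤ (K * dist x x₁) * (2 / κ * κ⁻¹) := by gcongr
        _ = 2 * K / κ ^ 2 * dist x x₁ := by field_simp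
    rw [h1]
    refine (norm_add_le _ _).trans ?_
    rw [norm_smul, norm_smul, Real.norm_eq_abs, Real.norm_eq_abs, ← dist_eq_norm x x₁,
      abs_of_pos (by positivity : 0 < γ⁻¹)]
    calc γ⁻¹ * dist x x₁ + |γ⁻¹ - κ⁻¹| * ‖x₁ - x₂‖
        ≤ 2 / κ * dist x x₁ + (2 * K / κ ^ 2 * dist x x₁) * ‖x₁ - x₂‖ := by gcongr
      _ = L * dist x x₁ := by rw [hL]; ring
  calc v x ≤ C * ‖b - x₀‖ ^ s := hvxb.trans (hC b hbfr)
    _ ≤ |C| * (L * dist x x₁) ^ s := by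
        gcongr
        exact le_abs_self C
    _ = |C| * L ^ s * dist x x₁ ^ s := by rw [Real.mul_rpow hL0.le hd0, mul_assoc]
    _ ≤ (|C| * L ^ s + 1) * dist x x₁ ^ s := by
        gcongr
        linarith

lemma apply_eq_zero_of_mem_freeBoundary {Ω : Set (EuclideanSpace ℝ (Fin n))}
    (hΩ_open : IsOpen Ω) {v : EuclideanSpace ℝ (Fin n) → ℝ} (hv : ContinuousOn v Ω)
    {x : EuclideanSpace ℝ (Fin n)} (hx : x ∈ freeBoundary Ω v) : v x = 0 := by
  by_contra hne
  have hcont : ContinuousAt v x := hv.continuousAt (hΩ_open.mem_nhds hx.1)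
  obtain ⟨y, hy, hyK⟩ := ((mem_closure_iff_frequently.1
    (frontier_subset_closure hx.2)).and_eventually (hcont.eventually_ne hne)).exists
  exact hyK hy.2

lemma exists_pos_of_mem_freeBoundary {Ω : Set (EuclideanSpace ℝ (Fin n))}
    (hΩ_open : IsOpen Ω) {v : EuclideanSpace ℝ (Fin n) → ℝ} (hv : ∀ x ∈ Ω, 0 ≤ v x)
    {x : EuclideanSpace ℝ (Fin n)} (hx : x ∈ freeBoundary Ω v) {ε : ℝ} (hε : 0 < ε) :
    ∃ z ∈ closedBall x ε, 0 < v z := by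
  by_contra! hcon
  refine hx.2.2 (mem_interior_iff_mem_nhds.2 ?_)
  filter_upwards [hΩ_open.mem_nhds hx.1, closedBall_mem_nhds x hε] with y hyΩ hy
  exact ⟨hyΩ, le_antisymm (hcon y hy) (hv y hyΩ)⟩

end MAObstacle

theorem theorem1p1 (n : ℕ) (q : ℝ) (hq0 : 0 ≤ q) (hqn : q < n)
    (Ω : Set (EuclideanSpace ℝ (Fin n)))
    (hΩ_open : IsOpen Ω) (hΩ_convex : Convex ℝ Ω) (hΩ_bounded : Bornology.IsBounded Ω)
    (v : EuclideanSpace ℝ (Fin n) → ℝ)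
    (hv_cont : ContinuousOn v (closure Ω)) (hv_convex : ConvexOn ℝ (closure Ω) v)
    (hv_nonneg : ∀ x ∈ closure Ω, 0 ≤ v x) (hv_ne : ∃ x ∈ closure Ω, v x ≠ 0)
    (hv_sub : MAObstacle.IsSubsolution Ω q v)
    (E : Set (EuclideanSpace ℝ (Fin n))) (hE_convex : Convex ℝ E)
    (hE : E ⊆ MAObstacle.nonStrictlyConvexPart Ω v) :
    (MAObstacle.convexDim E : ℝ) < ((n : ℝ) + q) / 2 ∧
      ∀ x₀ ∈ closure E ∩ frontier Ω, ∀ C s : ℝ, 1 < s →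
        (∀ x ∈ frontier Ω, v x ≤ C * ‖x - x₀‖ ^ s) →
          (MAObstacle.convexDim E : ℝ) ≤ (n : ℝ) - ((n : ℝ) - q) * s / 2 := by
  open MAObstacle in
  rcases E.eq_empty_or_nonempty with rfl | hne
  · have hdim : convexDim (∅ : Set (EuclideanSpace ℝ (Fin n))) = 0 := by
      simp [convexDim]
    refine ⟨?_, fun x₀ hx₀ => by simp at hx₀⟩
    rw [hdim, Nat.cast_zero]
    linarith
  have hsol : IsConvexSubsolution Ω q v :=
    { isOpen := hΩ_open
      isBounded := hΩ_bounded
      continuousOn := hv_cont.mono subset_closure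
      convexOn := hv_convex.subset subset_closure hΩ_convex
      nonneg := fun x hx => hv_nonneg x (subset_closure hx)
      q_nonneg := hq0
      isSubsolution := hv_sub }
  obtain ⟨x₁, hx₁E, r, hr, hball⟩ := exists_relative_ball_subset hE_convex hne
  set V := (affineSpan ℝ E).direction with hV
  have hEΓ : ∀ x ∈ E, x ∈ freeBoundary Ω v := fun x hx => (hE hx).1
  have hf : IsFlatPoint Ω v V x₁ r :=
    { radius_pos := hr
      flat := fun w hw hwr =>
        have hmem := hEΓ _ (hball w hw hwr)
        ⟨hmem.1, apply_eq_zero_of_mem_freeBoundary hΩ_open hsol.continuousOn hmem⟩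
      exists_pos := fun ε hε =>
        exists_pos_of_mem_freeBoundary hΩ_open hsol.nonneg (hEΓ x₁ hx₁E) hε }
  have hdim : (convexDim E : ℝ) + Module.finrank ℝ Vᗮ = n := by
    exact_mod_cast finrank_add_finrank_orthogonal_eq V
  refine ⟨?_, fun x₀ hx₀ C s hs hC => ?_⟩
  · obtain ⟨Λ, ρ, hΛ, hρ, -, hlin⟩ := hsol.exists_le_mul_dist hf.mem hf.apply_eq_zero
    have hle := hsol.mul_le_two_mul_finrank_orthogonal hqn hf hΛ zero_le_one hρ
      fun x _ hx => by rw [Real.rpow_one]; exact hlin x hx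
    rw [one_mul] at hle
    have hlt := lt_of_le_of_ne hle (hsol.two_mul_finrank_orthogonal_ne hqn hf).symm
    linarith
  · have hx₀V : x₀ - x₁ ∈ V :=
      AffineSubspace.vsub_mem_direction
        (closure_minimal (subset_affineSpan ℝ E)
          (AffineSubspace.closed_of_finiteDimensional _) hx₀.1)
        (subset_affineSpan ℝ E hx₁E)
    obtain ⟨C', ρ, hC', hρ, hgrowth⟩ := exists_growth_of_frontier hΩ_open hΩ_convex hv_convex
      hv_nonneg hf hx₀.2 hx₀V (by linarith) hC
    have hle := hsol.mul_le_two_mul_finrank_orthogonal hqn hf hC' (by linarith) hρ hgrowth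
    linarith
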